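/- \textbf{System.} Time is slotted. There are $N$ queues and one server. For each queue $j$ and each slot boundary $t=0,1,2,\dots$ let $A_j(t)\in\{0,1\}$ be the number of arrivals, with $P(A_j(t)=1)=\lambda_j$, all $A_j(t)$ independent. In each slot $t$ one queue $u_t$ is scheduled; it transmits one packet if it is nonempty, and otherwise the slot is wasted. Thus the backlogs satisfy $Q_j(t+1)=(Q_j(t)-D_j(t))^+ + A_j(t+1)$, where $D_j(t)=1$ if $j=u_t$ and $Q_j(t)>0$, and $D_j(t)=0$ otherwise. Let $V_j(t)$ be the number of slots since queue $j$ was last scheduled: $V_j(t+1)=0$ if $j=u_t$, and $V_j(t+1)=V_j(t)+1$ otherwise. The incumbent at time $t$ is the queue $u_{t-1}$ (at $t=0$ it is part of the initial state). \textbf{Longest Expected Queue (LEQ) policy.} If the incumbent is nonempty at the beginning of slot $t$, it is scheduled again. If it is empty, the queue scheduled in slot $t$ is one that attains $\max_{1\le i\le N}\lambda_i V_i(t)$, ties being broken by any fixed function of the current state. \textbf{Proposition.} If $\sum_{i=1}^N\lambda_i<1$ and $\min_{1\le i\le N}\lambda_i>0$, then the system is stable under the LEQ policy, for every tie-breaking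 rule. That is, the Markov chain $X(t)=(Q(t),V(t),u_{t-1})$ on $\mathbb{N}^N\times\mathbb{N}^N\times\{1,\dots,N\}$ is positive recurrent in the following sense (it need not be irreducible): (a) every recurrent state is positive recurrent, i.e. the mean return time to it is finite; (b) from every deterministic initial state, and also from $Q_j(0)=A_j(0)$ $(1\le j\le N)$ with arbitrary deterministic $V(0)$ and initial incumbent, the mean time until the chain enters the set of positive recurrent states is finite, and the mean of the first time $t\ge 1$ at which $Q(t)=0$ is finite. -/

import Mathlib

open MeasureTheory ProbabilityTheory
open scoped ENNReal

namespace Polling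

/-- State of the slotted single-server system with `N` queues at the beginning of a slot `t`:
the backlogs `Q_j(t)`, the numbers of slots `V_j(t)` since the queues were last scheduled
(`V_j(t) = 0` if `j` was scheduled in slot `t - 1`), and the incumbent, that is, the queue
scheduled in slot `t - 1`. -/
structure State (N : ℕ) where
  backlog : Fin N → ℕ
  age : Fin N → ℕ
  incumbent : Fin N

/-- A stationary Markov scheduling policy: the queue that is allowed to transmit in the
current slot, as a function of the state. -/
abbrev Policy (N : ℕ) := State N → Fin N

/-- The Longest Expected Queue policy, with an arbitrary tie-breaking rule. A nonempty
incumbent is scheduled again (exhaustive service); if the incumbent is empty, a queue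
maximising `lam i * V_i(t)` is scheduled. -/
def IsLEQ {N : ℕ} (lam : Fin N → ℝ) (π : Policy N) : Prop :=
  ∀ x : State N,
    (0 < x.backlog x.incumbent → π x = x.incumbent) ∧
    (x.backlog x.incumbent = 0 →
      ∀ j, lam j * (x.age j : ℝ) ≤ lam (π x) * (x.age (π x) : ℝ))

/-- Departures in a slot: the scheduled queue, if nonempty, sends exactly one packet. -/
def departure {N : ℕ} (π : Policy N) (x : State N) (j : Fin N) : ℕ :=
  if j = π x ∧ 0 < x.backlog j then 1 else 0

/-- One slot: `Q_j(t+1) = (Q_j(t) - D_j(t))⁺ + A_j(t+1)` (the subtraction in `ℕ` is the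
positive part); the scheduled queue becomes the incumbent and its age is reset to `0`,
the other ages increase by `1`. Scheduling an empty queue wastes the slot. -/
def next {N : ℕ} (π : Policy N) (x : State N) (a : Fin N → ℕ) : State N where
  backlog j := (x.backlog j - departure π x j) + a j
  age j := if j = π x then 0 else x.age j + 1
  incumbent := π x

variable {Ω : Type*}

/-- The process driven by the policy `π` and the arrivals `A t j`, with (possibly random)
initial state `X₀`. -/
def process {N : ℕ} (π : Policy N) (A : ℕ → Fin N → Ω → ℕ) (X₀ : Ω → State N) :
    ℕ → Ω → State N
  | 0, ω => X₀ ω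
  | t + 1, ω => next π (process π A X₀ t ω) (fun j => A (t + 1) j ω)

/-- The first time `t ≥ 1` at which the path `X · ω` is in `S` (`∞` if there is none). -/
noncomputable def hitTime {N : ℕ} (X : ℕ → Ω → State N) (S : Set (State N)) (ω : Ω) : ℝ≥0∞ :=
  ⨅ (t : ℕ) (_ : 1 ≤ t ∧ X t ω ∈ S), (t : ℝ≥0∞)

variable [MeasurableSpace Ω]

/-- The arrivals `A t j` are Bernoulli with rate `lam j`, independent over queues and slots. -/
structure IsBernoulliArrivals {N : ℕ} (lam : Fin N → ℝ) (A : ℕ → Fin N → Ω → ℕ)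
    (μ : Measure Ω) : Prop where
  measurable : ∀ t j, Measurable (A t j)
  zero_or_one : ∀ t j, ∀ᵐ ω ∂μ, A t j ω = 0 ∨ A t j ω = 1
  rate : ∀ t j, μ {ω | A t j ω = 1} = ENNReal.ofReal (lam j)
  indep : iIndepFun (fun p : ℕ × Fin N => A p.1 p.2) μ

/-- The mean of the first time `t ≥ 1` at which the process is in `S`. -/
noncomputable def meanHitTime {N : ℕ} (π : Policy N) (A : ℕ → Fin N → Ω → ℕ) (μ : Measure Ω)
    (X₀ : Ω → State N) (S : Set (State N)) : ℝ≥0∞ :=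
  ∫⁻ ω, hitTime (process π A X₀) S ω ∂μ

/-- The positive recurrent states: those to which the chain started there returns in finite
mean time. -/
def positiveRecurrentStates {N : ℕ} (π : Policy N) (A : ℕ → Fin N → Ω → ℕ)
    (μ : Measure Ω) : Set (State N) :=
  {x | meanHitTime π A μ (fun _ => x) {x} < ∞}

/-- The states in which all queues are empty. -/
def emptyStates (N : ℕ) : Set (State N) := {x | ∀ j, x.backlog j = 0}

/-- Stability from the initial state `X₀`: in finite mean time the chain enters the set of
positive recurrent states, and in finite mean time the backlog vector is (again) zero. -/
def StableFrom {N : ℕ} (π : Policy N) (A : ℕ → Fin N → Ω → ℕ) (μ : Measure Ω)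
    (X₀ : Ω → State N) : Prop :=
  meanHitTime π A μ X₀ (positiveRecurrentStates π A μ) < ∞ ∧
  meanHitTime π A μ X₀ (emptyStates N) < ∞

/-- Stability of the system: the Markov chain (backlogs, ages, incumbent) is positive recurrent.
It need not be irreducible (with equal rates the cyclic order of the visits is
preserved, so that there are several closed classes); positive recurrence then means that
no recurrent state is null recurrent and that the positive recurrent states are reached in
finite mean time from every state. Both the deterministic initial states
and the standard initial backlog `Q_j(0) = A_j(0)` are covered. -/
structure IsStable {N : ℕ} (π : Policy N) (A : ℕ → Fin N → Ω → ℕ) (μ : Measure Ω) : Prop where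
  recurrent_positive : ∀ x : State N,
    (∀ᵐ ω ∂μ, ∃ t, 1 ≤ t ∧ process π A (fun _ => x) t ω = x) →
      x ∈ positiveRecurrentStates π A μ
  from_state : ∀ x : State N, StableFrom π A μ (fun _ => x)
  from_arrivals : ∀ (v : Fin N → ℕ) (s : Fin N),
    StableFrom π A μ (fun ω => ⟨fun j => A 0 j ω, v, s⟩)

end Polling

/-! The proof is a Foster–Lyapunov argument with the function F(x) = ∑ⱼ (Qⱼ + c·1{Qⱼ = 0}(1 -
λⱼ)^(-Vⱼ)), where 2c = 1 - ∑λᵢ. A queue that is not scheduled contributes exactly λⱼ to the drift,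
because the exponential term absorbs the growth of its age. Serving a nonempty queue changes the
total drift by at most c - 1, which leaves at most -c. A wasted slot loses the exponential term of
the scheduled queue, and this is enough when that queue is old. Under LEQ it is old as soon as some
λᵢVᵢ is large, since λ < 1. Hence the drift fails to be at most -c only when the incumbent is empty
and all ages are small (`exists_drift`).

That exceptional set is infinite, but a queue left unserved gains at most one packet per slot, so Qⱼ
≤ Vⱼ + B persists for all queues except the incumbent. On this closed set (`step_mem_boundedExcess`)
only finitely many exceptional states remain, and every initial state lies in such a set for some B.

From a finite exceptional set, `exists_lyapunov` passes to any target T that each exceptional state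
hits with positive probability: the Lyapunov function is corrected by multiples of truncated
expected hitting times. `meanHitTime_lt_top` turns the corrected function into a bound on the mean
hitting time. It remains to check accessibility of three kinds of target: the empty states (let
arrivals cease), a recurrent state, and the set of positive recurrent states. The last uses a state
in a minimal communicating part of the finite exceptional set. -/

namespace Polling

/-! ### Chains driven by finitely many noise values -/

section Chain

variable {S α : Type*}

/-- One transition of positive probability. -/
def Step (step : S → α → S) (x y : S) : Prop := ∃ a, step x a = y

/-- Reachability in at least one transition. -/
abbrev Reach (step : S → α → S) : S → S → Prop := Relation.TransGen (Step step)

variable {w : α → ℝ} {step : S → α → S} {T : Set S}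

/-- A finite set that is reached from everywhere contains, for every starting point, a reachable
element to which all the elements of the set reachable from it lead back. -/
lemma exists_reach_minimal {I D : Set S} (hD : D.Finite) (hDI : D ⊆ I)
    (hreach : ∀ x ∈ I, ∃ y ∈ D, Reach step x y) {x : S} (hx : x ∈ I) :
    ∃ y ∈ D, Reach step x y ∧ ∀ z ∈ D, Reach step y z → Reach step z y := by
  classical
  set c : S → Finset S := fun y => hD.toFinset.filter (Reach step y) with hc
  have hcmono : ∀ y z, Reach step y z → c z ⊆ c y := by
    intro y z hyz u hu
    simp only [hc, Finset.mem_filter] at hu ⊢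
    exact ⟨hu.1, hyz.trans hu.2⟩
  have hne : (c x).Nonempty := by
    obtain ⟨y, hy, hr⟩ := hreach x hx
    exact ⟨y, by simp [hc, hy, hr]⟩
  -- Reachable sets shrink along paths, so a smallest one among the points of `D` reachable from `x`
  -- is shared by everything in `D` further along.
  obtain ⟨y, hy, hmin⟩ := Finset.exists_min_image (c x) (fun y => (c y).card) hne
  have heq : ∀ z, Reach step y z → z ∈ D → c z = c y := fun z hz hzD =>
    Finset.eq_of_subset_of_card_le (hcmono y z hz)
      (hmin z (hcmono x y (Finset.mem_filter.1 hy).2 (by simp [hc, hz, hzD])))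
  simp only [hc, Finset.mem_filter, Set.Finite.mem_toFinset] at hy
  -- Reachability needs at least one transition, so `y` need not lie in `c y`; a point `u` of `c y`
  -- is used instead.
  obtain ⟨u, huD, hu⟩ := hreach y (hDI hy.1)
  refine ⟨u, huD, hy.2.trans hu, fun z hz huz => ?_⟩
  have h1 : u ∈ c z := by
    rw [heq z (hu.trans huz) hz]
    simp [hc, huD, hu]
  exact (Finset.mem_filter.1 h1).2

/-! ### The killed transition operator and Foster–Lyapunov functions -/

variable [Fintype α]

/-- The transition operator of the chain `x ↦ step x a`, where `a` is drawn with weight `w a`,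
killed on entering `T`. -/
noncomputable def killed (w : α → ℝ) (step : S → α → S) (T : Set S) (f : S → ℝ) (x : S) : ℝ :=
  ∑ a, w a * Tᶜ.indicator f (step x a)

/-- The probability that the chain avoids `T` at the times `1, …, n`. -/
noncomputable def survival (w : α → ℝ) (step : S → α → S) (T : Set S) (n : ℕ) : S → ℝ :=
  (killed w step T)^[n] fun _ => 1

lemma killed_nonneg (hw : ∀ a, 0 < w a) {f : S → ℝ} (hf : ∀ x, 0 ≤ f x) (x : S) :
    0 ≤ killed w step T f x :=
  Finset.sum_nonneg fun a _ =>
    mul_nonneg (hw a).le (Set.indicator_nonneg (fun y _ => hf y) _)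

lemma killed_mono (hw : ∀ a, 0 < w a) {f g : S → ℝ} (hfg : ∀ x, f x ≤ g x) (x : S) :
    killed w step T f x ≤ killed w step T g x :=
  Finset.sum_le_sum fun a _ =>
    mul_le_mul_of_nonneg_left (Set.indicator_le_indicator (hfg _)) (hw a).le

lemma killed_add (f g : S → ℝ) (x : S) :
    killed w step T (fun y => f y + g y) x = killed w step T f x + killed w step T g x := by
  simp only [killed, ← Finset.sum_add_distrib, ← mul_add, Set.indicator_add]

lemma killed_const_mul (c : ℝ) (f : S → ℝ) (x : S) :
    killed w step T (fun y => c * f y) x = c * killed w step T f x := by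
  simp only [killed, Finset.mul_sum, Set.indicator_const_mul]
  exact Finset.sum_congr rfl fun a _ => by ring

lemma killed_finset_sum {ι : Type*} (s : Finset ι) (f : ι → S → ℝ) (x : S) :
    killed w step T (fun y => ∑ i ∈ s, f i y) x = ∑ i ∈ s, killed w step T (f i) x := by
  classical
  induction s using Finset.induction_on with
  | empty => simp [killed]
  | insert i s hi ih => simp only [Finset.sum_insert hi, killed_add, ih]

lemma killed_le_sum (hw : ∀ a, 0 < w a) {f : S → ℝ} (hf : ∀ x, 0 ≤ f x) (x : S) :
    killed w step T f x ≤ ∑ a, w a * f (step x a) :=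
  Finset.sum_le_sum fun a _ =>
    mul_le_mul_of_nonneg_left (Set.indicator_le_self' (fun y _ => hf y) _) (hw a).le

lemma survival_succ (n : ℕ) (x : S) :
    survival w step T (n + 1) x = killed w step T (survival w step T n) x := by
  simp only [survival, Function.iterate_succ_apply']

lemma survival_nonneg (hw : ∀ a, 0 < w a) (n : ℕ) (x : S) : 0 ≤ survival w step T n x := by
  induction n generalizing x with
  | zero => simp [survival]
  | succ n ih => rw [survival_succ]; exact killed_nonneg hw ih x

lemma survival_le_one (hw : ∀ a, 0 < w a) (hw1 : ∑ a, w a = 1) (n : ℕ) (x : S) :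
    survival w step T n x ≤ 1 := by
  induction n generalizing x with
  | zero => simp [survival]
  | succ n ih =>
    rw [survival_succ]
    refine (killed_mono hw ih x).trans ((killed_le_sum hw (fun _ => zero_le_one) x).trans ?_)
    simp [hw1]

lemma survival_succ_lt_one (hw : ∀ a, 0 < w a) (hw1 : ∑ a, w a = 1) {n : ℕ} {x : S} (a : α)
    (h : Tᶜ.indicator (survival w step T n) (step x a) < 1) :
    survival w step T (n + 1) x < 1 := by
  rw [survival_succ, killed, ← hw1]
  refine Finset.sum_lt_sum (fun b _ => ?_) ⟨a, Finset.mem_univ _, ?_⟩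
  · refine mul_le_of_le_one_right (hw b).le ?_
    exact (Set.indicator_le_self' (fun y _ => survival_nonneg hw n y) _).trans
      (survival_le_one hw hw1 n _)
  · exact mul_lt_of_lt_one_right (hw a) h

lemma exists_survival_lt_one_of_reach (hw : ∀ a, 0 < w a) (hw1 : ∑ a, w a = 1) {x y : S}
    (h : Reach step x y) (hy : y ∈ T) : ∃ m, survival w step T m x < 1 := by
  induction h using Relation.TransGen.head_induction_on with
  | single h =>
    obtain ⟨a, rfl⟩ := h
    exact ⟨1, survival_succ_lt_one hw hw1 a (by simp [hy])⟩
  | head h _ ih =>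
    obtain ⟨a, rfl⟩ := h
    obtain ⟨m, hm⟩ := ih
    refine ⟨m + 1, survival_succ_lt_one hw hw1 a ?_⟩
    exact (Set.indicator_le_self' (fun y _ => survival_nonneg hw m y) _).trans_lt hm

/-- The sum is the mean of the hitting time of `T` truncated at `m`. Applying the operator shifts
the index by one, so the sum drops by the probability of hitting `T` within `m` steps. -/
lemma killed_sum_survival (m : ℕ) (x : S) :
    killed w step T (fun y => ∑ k ∈ Finset.range m, survival w step T k y) x
      = ∑ k ∈ Finset.range m, survival w step T k x - 1 + survival w step T m x := by
  rw [killed_finset_sum]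
  simp only [← survival_succ]
  have h1 := Finset.sum_range_succ (fun k => survival w step T k x) m
  have h2 := Finset.sum_range_succ' (fun k => survival w step T k x) m
  have h3 : survival w step T 0 x = 1 := rfl
  linarith

/-- A Foster–Lyapunov function for a finite set `C ∩ I`, from each point of which `T` is reached
with positive probability, gives one for `T`. -/
lemma exists_lyapunov (hw : ∀ a, 0 < w a) (hw1 : ∑ a, w a = 1) {I C : Set S}
    (hC : (C ∩ I).Finite) {F : S → ℝ} (hF0 : ∀ x, 0 ≤ F x) {ε b : ℝ} (hε : 0 < ε) (hb : 0 ≤ b)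
    (hF : ∀ x ∈ I, ∑ a, w a * F (step x a) ≤ F x - ε + C.indicator (fun _ => b) x)
    (hT : ∀ y ∈ C ∩ I, ∃ m, survival w step T m y < 1) :
    ∃ G : S → ℝ, (∀ x, 0 ≤ G x) ∧ ∀ x ∈ I, killed w step T G x + 1 ≤ G x := by
  classical
  choose! m hm using hT
  set q : S → S → ℝ := fun y => survival w step T (m y) with hq
  set Φ : S → S → ℝ := fun y x => ∑ k ∈ Finset.range (m y), survival w step T k x with hΦ
  -- With this coefficient the drop of `L y * Φ y` at the point `y` is exactly `b`, which cancels
  -- the exceptional drift there; at all other points the drop is nonnegative.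
  set L : S → ℝ := fun y => b / (1 - q y y) with hL
  have hL0 : ∀ y ∈ hC.toFinset, 0 ≤ L y := fun y hy =>
    div_nonneg hb (sub_nonneg.2 (survival_le_one hw hw1 _ _))
  have hΦ0 : ∀ y x, 0 ≤ Φ y x := fun y x => Finset.sum_nonneg fun k _ => survival_nonneg hw k x
  set H : S → ℝ := fun x => F x + ∑ y ∈ hC.toFinset, L y * Φ y x with hH
  have hH0 : ∀ x, 0 ≤ H x := fun x =>
    add_nonneg (hF0 x) (Finset.sum_nonneg fun y hy => mul_nonneg (hL0 y hy) (hΦ0 y x))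
  have hdrop : ∀ x ∈ I, C.indicator (fun _ => b) x
      ≤ ∑ y ∈ hC.toFinset, L y * (1 - q y x) := by
    intro x hx
    have hterm : ∀ y ∈ hC.toFinset, 0 ≤ L y * (1 - q y x) := fun y hy =>
      mul_nonneg (hL0 y hy) (sub_nonneg.2 (survival_le_one hw hw1 _ _))
    by_cases hxC : x ∈ C
    · have hmem : x ∈ hC.toFinset := hC.mem_toFinset.2 ⟨hxC, hx⟩
      have hpos : 0 < 1 - q x x := sub_pos.2 (hm x ⟨hxC, hx⟩)
      calc C.indicator (fun _ => b) x = L x * (1 - q x x) := by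
            rw [Set.indicator_of_mem hxC, hL]; field_simp
        _ ≤ _ := Finset.single_le_sum hterm hmem
    · rw [Set.indicator_of_notMem hxC]
      exact Finset.sum_nonneg hterm
  refine ⟨fun x => ε⁻¹ * H x, fun x => mul_nonneg (inv_nonneg.2 hε.le) (hH0 x), fun x hx => ?_⟩
  have hkH : killed w step T H x ≤ H x - ε := by
    have h1 : killed w step T F x ≤ F x - ε + C.indicator (fun _ => b) x :=
      (killed_le_sum hw hF0 x).trans (hF x hx)
    have h2 : killed w step T (fun x => ∑ y ∈ hC.toFinset, L y * Φ y x) x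
        = ∑ y ∈ hC.toFinset, L y * Φ y x - ∑ y ∈ hC.toFinset, L y * (1 - q y x) := by
      rw [killed_finset_sum, ← Finset.sum_sub_distrib]
      refine Finset.sum_congr rfl fun y _ => ?_
      rw [killed_const_mul, hΦ, killed_sum_survival, hq]
      ring
    rw [hH, killed_add, h2]
    have := hdrop x hx
    linarith
  rw [killed_const_mul]
  have : ε⁻¹ * killed w step T H x ≤ ε⁻¹ * (H x - ε) :=
    mul_le_mul_of_nonneg_left hkH (inv_nonneg.2 hε.le)
  have h1 : ε⁻¹ * ε = 1 := inv_mul_cancel₀ hε.ne'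
  linarith [mul_sub ε⁻¹ (H x) ε]

/-- Under a drift condition the exceptional set is reached. -/
lemma exists_reach_of_drift (hw : ∀ a, 0 < w a) (hw1 : ∑ a, w a = 1) {I C : Set S}
    (hI : ∀ x ∈ I, ∀ a, step x a ∈ I) {F : S → ℝ} (hF0 : ∀ x, 0 ≤ F x) {ε b : ℝ} (hε : 0 < ε)
    (hF : ∀ x ∈ I, ∑ a, w a * F (step x a) ≤ F x - ε + C.indicator (fun _ => b) x)
    {x : S} (hx : x ∈ I) : ∃ y ∈ C ∩ I, Reach step x y := by
  have key : ∀ (n : ℕ) (x : S), x ∈ I → F x < n * ε →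
      ∃ y ∈ C ∩ I, Relation.ReflTransGen (Step step) x y := by
    intro n
    induction n with
    | zero => intro x _ h; simp at h; exact absurd (hF0 x) (not_le.2 h)
    | succ n ih =>
      intro x hx h
      by_cases hxC : x ∈ C
      · exact ⟨x, ⟨hxC, hx⟩, .refl⟩
      have h1 := hF x hx
      rw [Set.indicator_of_notMem hxC, add_zero] at h1
      -- Some outcome does at least as well as the average, so outside `C` a path can be chosen
      -- along which `F` falls by `ε` at each step.
      obtain ⟨a, ha⟩ : ∃ a, F (step x a) ≤ F x - ε := by
        by_contra! hcon
        have hne : (Finset.univ : Finset α).Nonempty := by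
          rw [Finset.nonempty_iff_ne_empty]
          intro h0
          simp [h0] at hw1
        have : ∑ a, w a * (F x - ε) < ∑ a, w a * F (step x a) :=
          Finset.sum_lt_sum_of_nonempty hne fun a _ => mul_lt_mul_of_pos_left (hcon a) (hw a)
        rw [← Finset.sum_mul, hw1, one_mul] at this
        linarith
      push_cast at h
      obtain ⟨y, hy, hr⟩ := ih (step x a) (hI x hx a) (by linarith)
      exact ⟨y, hy, .head ⟨a, rfl⟩ hr⟩
  have hne : Nonempty α := by
    by_contra h0
    rw [not_nonempty_iff] at h0
    simp at hw1
  obtain ⟨a⟩ := hne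
  obtain ⟨n, hn⟩ := exists_nat_gt (F (step x a) / ε)
  obtain ⟨y, hy, hr⟩ := key n (step x a) (hI x hx a) ((div_lt_iff₀ hε).1 hn)
  exact ⟨y, hy, .head' ⟨a, rfl⟩ hr⟩

end Chain

/-! ### The Markov property -/

lemma lintegral_mul_indicator_of_indep {Ω : Type*} {m₁ m₂ mΩ : MeasurableSpace Ω}
    {μ : Measure Ω} (h₁ : m₁ ≤ mΩ) (h₂ : m₂ ≤ mΩ) (hind : Indep m₁ m₂ μ) {g : Ω → ℝ≥0∞}
    (hg : Measurable[m₁] g) {B : Set Ω} (hB : MeasurableSet[m₂] B) :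
    ∫⁻ ω, g ω * B.indicator (fun _ => 1) ω ∂μ = μ B * ∫⁻ ω, g ω ∂μ := by
  have hBm : Measurable[m₂] (B.indicator fun _ => (1 : ℝ≥0∞)) :=
    Measurable.indicator (@measurable_const _ _ _ m₂ 1) hB
  rw [lintegral_mul_eq_lintegral_mul_lintegral_of_independent_measurableSpace h₁ h₂ hind hg hBm,
    lintegral_indicator_const (h₂ _ hB), one_mul, mul_comm]

section Law

variable {N : ℕ}

instance : MeasurableSpace (State N) := ⊤

instance : DiscreteMeasurableSpace (State N) := ⟨fun _ => trivial⟩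

/-- Countability makes products with `State N` discrete, so that every map out of them is
measurable. -/
instance : Countable (State N) :=
  Function.Injective.countable (f := fun x : State N => (x.backlog, x.age, x.incumbent))
    fun x y h => by
      cases x; cases y; simpa using h

/-- Arrival vectors as numbers. -/
def arrivals (a : Fin N → Bool) (j : Fin N) : ℕ := (a j).toNat

lemma arrivals_injective : Function.Injective (arrivals (N := N)) := fun a b h => by
  funext j
  have := congrFun h j
  simp only [arrivals] at this
  cases h1 : a j <;> cases h2 : b j <;> simp_all

/-- The transition of the chain given the arrival vector. -/
def step (π : Policy N) (x : State N) (a : Fin N → Bool) : State N := next π x (arrivals a)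

/-- The probability of an arrival, or of no arrival, at a queue. -/
noncomputable def bitWeight (lam : Fin N → ℝ) (j : Fin N) (b : Bool) : ℝ :=
  if b then lam j else 1 - lam j

/-- The probability of an arrival vector. -/
noncomputable def weight (lam : Fin N → ℝ) (a : Fin N → Bool) : ℝ :=
  ∏ j, bitWeight lam j (a j)

variable {lam : Fin N → ℝ} {π : Policy N} {Ω : Type*} {A : ℕ → Fin N → Ω → ℕ}

lemma bitWeight_pos (hpos : ∀ i, 0 < lam i) (hlt : ∀ i, lam i < 1) (j : Fin N) (b : Bool) :
    0 < bitWeight lam j b := by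
  cases b <;> simp [bitWeight, hpos, hlt]

lemma weight_pos (hpos : ∀ i, 0 < lam i) (hlt : ∀ i, lam i < 1) (a : Fin N → Bool) :
    0 < weight lam a :=
  Finset.prod_pos fun _ _ => bitWeight_pos hpos hlt _ _

lemma sum_weight_mul (i : Fin N) (f : Bool → ℝ) :
    ∑ a, weight lam a * f (a i) = lam i * f true + (1 - lam i) * f false := by
  have h : ∀ a : Fin N → Bool, weight lam a * f (a i)
      = ∏ j, bitWeight lam j (a j) * (if j = i then f (a j) else 1) := fun a => by
    rw [Finset.prod_mul_distrib, weight]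
    simp
  simp only [h]
  rw [← Fintype.prod_sum (fun j b => bitWeight lam j b * (if j = i then f b else 1)),
    Finset.prod_eq_single i]
  · simp [bitWeight]
  · intro j _ hj
    simp [bitWeight, hj]
  · simp

lemma sum_weight : ∑ a, weight lam a = 1 := by
  simp only [weight]
  rw [← Fintype.prod_sum (fun j b => bitWeight lam j b)]
  simp [bitWeight]

/-- The events determined by the arrivals with time index in `s`. -/
@[reducible] def arrivalSigma (A : ℕ → Fin N → Ω → ℕ) (s : Set ℕ) : MeasurableSpace Ω :=
  ⨆ p ∈ {p : ℕ × Fin N | p.1 ∈ s}, MeasurableSpace.comap (A p.1 p.2) ⊤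

lemma measurable_vector_arrivalSigma {s : Set ℕ} {t : ℕ} (ht : t ∈ s) :
    Measurable[arrivalSigma A s] fun ω j => A t j ω := by
  refine @measurable_pi_lambda _ _ _ (arrivalSigma A s) _ _ fun j => ?_
  refine Measurable.mono (comap_measurable (A t j)) ?_ le_rfl
  exact le_iSup₂_of_le (f := fun (p : ℕ × Fin N) (_ : p ∈ {p : ℕ × Fin N | p.1 ∈ s}) =>
    MeasurableSpace.comap (A p.1 p.2) ⊤) (t, j) ht le_rfl

/-- The process started at a function of the arrivals at time `0`. -/
abbrev chain (π : Policy N) (A : ℕ → Fin N → Ω → ℕ) (φ : (Fin N → ℕ) → State N) :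
    ℕ → Ω → State N :=
  process π A fun ω => φ fun j => A 0 j ω

variable {φ : (Fin N → ℕ) → State N} {T : Set (State N)}

lemma measurable_chain (t : ℕ) : Measurable[arrivalSigma A (Set.Iic t)] (chain π A φ t) := by
  have hmono : ∀ {t t' : ℕ}, t ≤ t' → arrivalSigma A (Set.Iic t) ≤ arrivalSigma A (Set.Iic t') :=
    fun h => biSup_mono fun p hp => le_trans (Set.mem_Iic.1 hp) h
  induction t with
  | zero =>
    exact (Measurable.of_discrete (f := φ)).comp
      (measurable_vector_arrivalSigma (A := A) (Set.mem_Iic.2 le_rfl))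
  | succ t ih =>
    have h2 := measurable_vector_arrivalSigma (A := A) (Set.mem_Iic.2 (le_refl (t + 1)))
    exact (Measurable.of_discrete
      (f := fun p : State N × (Fin N → ℕ) => next π p.1 p.2)).comp
      (Measurable.prodMk (ih.mono (hmono t.le_succ) le_rfl) h2)

/-! ### Paths that have not yet hit the target -/

/-- The indicator of the event that `T` is avoided at the times `1, …, t`. -/
noncomputable def alive (X : ℕ → Ω → State N) (T : Set (State N)) (t : ℕ) (ω : Ω) : ℝ≥0∞ :=
  ∏ s ∈ Finset.range t, Tᶜ.indicator 1 (X (s + 1) ω)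

lemma alive_succ (X : ℕ → Ω → State N) (t : ℕ) (ω : Ω) :
    alive X T (t + 1) ω = alive X T t ω * Tᶜ.indicator 1 (X (t + 1) ω) :=
  Finset.prod_range_succ _ _

lemma alive_le_one (X : ℕ → Ω → State N) (t : ℕ) (ω : Ω) : alive X T t ω ≤ 1 :=
  Finset.prod_le_one' fun s _ => Set.indicator_le_self' (by simp) _

lemma alive_eq_zero {X : ℕ → Ω → State N} {s t : ℕ} {ω : Ω} (hs : 1 ≤ s) (hst : s ≤ t)
    (h : X s ω ∈ T) : alive X T t ω = 0 := by
  refine Finset.prod_eq_zero (i := s - 1) (by simp; omega) ?_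
  rw [Nat.sub_add_cancel hs]
  simp [h]

lemma alive_eq_one {X : ℕ → Ω → State N} {t : ℕ} {ω : Ω}
    (h : ∀ s, 1 ≤ s → s ≤ t → X s ω ∉ T) : alive X T t ω = 1 := by
  refine Finset.prod_eq_one fun s hs => ?_
  have := h (s + 1) (by omega) (by simp at hs; omega)
  simp [this]

/-- The indicator equals one at every time before the first hit, including time 0, so these terms
already add up to the hitting time; without a hit the series diverges. -/
lemma hitTime_le_tsum_alive (X : ℕ → Ω → State N) (ω : Ω) :
    hitTime X T ω ≤ ∑' t, alive X T t ω := by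
  classical
  by_cases h : ∃ t, 1 ≤ t ∧ X t ω ∈ T
  · refine (iInf₂_le (Nat.find h) (Nat.find_spec h)).trans ?_
    refine le_trans ?_ (ENNReal.sum_le_tsum (Finset.range (Nat.find h)))
    rw [Finset.sum_congr rfl fun t ht => alive_eq_one fun s hs hst hX =>
      Nat.find_min h (lt_of_le_of_lt hst (Finset.mem_range.1 ht)) ⟨hs, hX⟩]
    simp
  · push Not at h
    have : ∀ t, alive X T t ω = 1 := fun t => alive_eq_one fun s hs _ => h s hs
    simp [this]

lemma measurable_alive (t : ℕ) :
    Measurable[arrivalSigma A (Set.Iic t)] (alive (chain π A φ) T t) := by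
  have hmono : ∀ {t t' : ℕ}, t ≤ t' → arrivalSigma A (Set.Iic t) ≤ arrivalSigma A (Set.Iic t') :=
    fun h => biSup_mono fun p hp => le_trans (Set.mem_Iic.1 hp) h
  refine Finset.measurable_prod _ fun s hs => ?_
  exact (Measurable.of_discrete (f := (Tᶜ.indicator 1 : State N → ℝ≥0∞))).comp
    ((measurable_chain (s + 1)).mono (hmono (by simp at hs; omega)) le_rfl)

lemma ofReal_killed (hpos : ∀ i, 0 < lam i) (hlt : ∀ i, lam i < 1) {f : State N → ℝ}
    (hf : ∀ x, 0 ≤ f x) (x : State N) :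
    ∑ a, ENNReal.ofReal (weight lam a) * Tᶜ.indicator (fun y => ENNReal.ofReal (f y)) (step π x a)
      = ENNReal.ofReal (killed (weight lam) (step π) T f x) := by
  rw [killed, ENNReal.ofReal_sum_of_nonneg fun a _ => mul_nonneg (weight_pos hpos hlt a).le
    (Set.indicator_nonneg (fun y _ => hf y) _)]
  refine Finset.sum_congr rfl fun a _ => ?_
  rw [ENNReal.ofReal_mul (weight_pos hpos hlt a).le]
  by_cases hT : step π x a ∈ T <;> simp [hT]

/-! ### The law of the arrivals and bounds on mean hitting times -/

variable [MeasurableSpace Ω] {μ : Measure Ω}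

lemma IsBernoulliArrivals.ae_eq_arrivals (hA : IsBernoulliArrivals lam A μ) (t : ℕ) :
    ∀ᵐ ω ∂μ, ∃ a, (fun j => A t j ω) = arrivals a := by
  filter_upwards [ae_all_iff.2 fun j => hA.zero_or_one t j] with ω h
  refine ⟨fun j => A t j ω = 1, funext fun j => ?_⟩
  rcases h j with h | h <;> simp [arrivals, h]

lemma IsBernoulliArrivals.measurable_vector (hA : IsBernoulliArrivals lam A μ) (t : ℕ) :
    Measurable fun ω j => A t j ω :=
  measurable_pi_lambda _ fun j => hA.measurable t j

lemma IsBernoulliArrivals.arrivalSigma_le (hA : IsBernoulliArrivals lam A μ) (s : Set ℕ) :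
    arrivalSigma A s ≤ ‹MeasurableSpace Ω› :=
  iSup₂_le fun p _ => (hA.measurable p.1 p.2).comap_le

lemma IsBernoulliArrivals.indep_arrivalSigma (hA : IsBernoulliArrivals lam A μ) {s s' : Set ℕ}
    (h : Disjoint s s') : Indep (arrivalSigma A s) (arrivalSigma A s') μ := by
  refine indep_iSup_of_disjoint (m := fun p : ℕ × Fin N => MeasurableSpace.comap (A p.1 p.2) ⊤)
    (fun p => (hA.measurable p.1 p.2).comap_le) ((iIndepFun_iff_iIndep _ _ _).1 hA.indep) ?_
  exact Set.disjoint_left.2 fun p hp hp' => Set.disjoint_left.1 h hp hp'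

variable [IsProbabilityMeasure μ]

lemma IsBernoulliArrivals.measure_bit (hA : IsBernoulliArrivals lam A μ) (t : ℕ) (j : Fin N)
    (hpos : 0 < lam j) (b : Bool) :
    μ (A t j ⁻¹' {b.toNat}) = ENNReal.ofReal (bitWeight lam j b) := by
  have h1 : μ (A t j ⁻¹' {1}) = ENNReal.ofReal (lam j) := hA.rate t j
  cases b
  · have h0 : (A t j ⁻¹' {0} : Set Ω) =ᵐ[μ] ((A t j ⁻¹' {1})ᶜ : Set Ω) := by
      refine Filter.eventuallyEq_set.2 ?_
      filter_upwards [hA.zero_or_one t j] with ω h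
      rcases h with h | h <;> simp [h]
    have hm : MeasurableSet (A t j ⁻¹' {1}) := hA.measurable t j (measurableSet_singleton 1)
    simp only [Bool.toNat_false, bitWeight, Bool.false_eq_true, if_false]
    rw [measure_congr h0, prob_compl_eq_one_sub hm, h1, ENNReal.ofReal_sub _ hpos.le,
      ENNReal.ofReal_one]
  · simpa [bitWeight] using h1

lemma IsBernoulliArrivals.measure_vector (hA : IsBernoulliArrivals lam A μ)
    (hpos : ∀ i, 0 < lam i) (hlt : ∀ i, lam i < 1) (t : ℕ) (a : Fin N → Bool) :
    μ ((fun ω j => A t j ω) ⁻¹' {arrivals a}) = ENNReal.ofReal (weight lam a) := by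
  classical
  have hset : ((fun ω j => A t j ω) ⁻¹' {arrivals a} : Set Ω)
      = ⋂ p ∈ ({t} ×ˢ Finset.univ : Finset (ℕ × Fin N)), A p.1 p.2 ⁻¹' {(a p.2).toNat} := by
    ext ω
    simp [funext_iff, arrivals]
  rw [hset, hA.indep.measure_inter_preimage_eq_mul (sets := fun p => {(a p.2).toNat})
    ({t} ×ˢ Finset.univ) (fun _ _ => measurableSet_singleton _), Finset.prod_product]
  simp only [Finset.prod_singleton, weight]
  rw [ENNReal.ofReal_prod_of_nonneg fun j _ => (bitWeight_pos hpos hlt _ _).le]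
  exact Finset.prod_congr rfl fun j _ => hA.measure_bit t j (hpos j) _

lemma lintegral_mul_indicator_vector (hA : IsBernoulliArrivals lam A μ) (hpos : ∀ i, 0 < lam i)
    (hlt : ∀ i, lam i < 1) (t : ℕ) (a : Fin N → Bool) {g : Ω → ℝ≥0∞}
    (hg : Measurable[arrivalSigma A (Set.Iic t)] g) :
    ∫⁻ ω, g ω * ((fun ω j => A (t + 1) j ω) ⁻¹' {arrivals a}).indicator (fun _ => 1) ω ∂μ
      = ENNReal.ofReal (weight lam a) * ∫⁻ ω, g ω ∂μ := by
  have hind : Indep (arrivalSigma A (Set.Iic t)) (arrivalSigma A {t + 1}) μ :=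
    hA.indep_arrivalSigma (by simp)
  have hB : MeasurableSet[arrivalSigma A {t + 1}]
      ((fun ω j => A (t + 1) j ω) ⁻¹' {arrivals a}) :=
    measurable_vector_arrivalSigma (Set.mem_singleton _) (measurableSet_singleton _)
  have := lintegral_mul_indicator_of_indep (hA.arrivalSigma_le _) (hA.arrivalSigma_le _) hind hg hB
  rw [this, hA.measure_vector hpos hlt]

/-- The Markov property, for the chain killed on entering `T`. -/
lemma lintegral_alive_succ_mul (hA : IsBernoulliArrivals lam A μ) (hpos : ∀ i, 0 < lam i)
    (hlt : ∀ i, lam i < 1) (t : ℕ) (h : State N → ℝ≥0∞) :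
    ∫⁻ ω, alive (chain π A φ) T (t + 1) ω * h (chain π A φ (t + 1) ω) ∂μ
      = ∫⁻ ω, alive (chain π A φ) T t ω *
          ∑ a, ENNReal.ofReal (weight lam a) *
            Tᶜ.indicator h (step π (chain π A φ t ω) a) ∂μ := by
  classical
  set X := chain π A φ
  have hle := hA.arrivalSigma_le (Set.Iic t)
  have hm : ∀ a, Measurable[arrivalSigma A (Set.Iic t)]
      fun ω => alive X T t ω * Tᶜ.indicator h (step π (X t ω) a) := fun a =>
    (measurable_alive t).mul ((Measurable.of_discrete
      (f := fun x : State N => Tᶜ.indicator h (step π x a))).comp (measurable_chain t))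
  -- Split according to the value of the next arrival vector, which almost surely is one of finitely
  -- many 0-1 vectors and is independent of the past.
  have hae : (fun ω => alive X T (t + 1) ω * h (X (t + 1) ω)) =ᵐ[μ] fun ω =>
      ∑ a, alive X T t ω * Tᶜ.indicator h (step π (X t ω) a) *
        ((fun ω j => A (t + 1) j ω) ⁻¹' {arrivals a}).indicator (fun _ => 1) ω := by
    filter_upwards [hA.ae_eq_arrivals (t + 1)] with ω ⟨a, ha⟩
    rw [Finset.sum_eq_single a]
    · have hX : X (t + 1) ω = step π (X t ω) a := congrArg (next π (X t ω)) ha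
      have hmem : ω ∈ (fun ω j => A (t + 1) j ω) ⁻¹' {arrivals a} := ha
      rw [alive_succ, hX, Set.indicator_of_mem hmem, mul_one, mul_assoc]
      by_cases hT : step π (X t ω) a ∈ T <;> simp [hT]
    · intro b _ hb
      have hmem : ω ∉ (fun ω j => A (t + 1) j ω) ⁻¹' {arrivals b} := fun hmem =>
        hb (arrivals_injective (Eq.trans (Eq.symm hmem) ha))
      rw [Set.indicator_of_notMem hmem, mul_zero]
    · simp
  rw [lintegral_congr_ae hae, lintegral_finsetSum]
  · simp only [Finset.mul_sum]
    rw [lintegral_finsetSum]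
    · refine Finset.sum_congr rfl fun a _ => ?_
      rw [lintegral_mul_indicator_vector hA hpos hlt t a (hm a),
        ← lintegral_const_mul _ ((hm a).mono hle le_rfl)]
      exact lintegral_congr fun ω => by ring
    · intro a _
      have := ((hm a).mono hle le_rfl).const_mul (ENNReal.ofReal (weight lam a))
      convert this using 2
      ring
  · intro a _
    exact ((hm a).mono hle le_rfl).mul
      (measurable_const.indicator (hA.measurable_vector _ (measurableSet_singleton _)))

/-- Each slot survived costs one unit of `G`. Telescoping bounds the sum of the survival
probabilities, hence the mean hitting time, by the initial mean of `G`. -/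
lemma meanHitTime_lt_top (hA : IsBernoulliArrivals lam A μ) (hpos : ∀ i, 0 < lam i)
    (hlt : ∀ i, lam i < 1) {I : Set (State N)} (hI : ∀ x ∈ I, ∀ a, step π x a ∈ I)
    {G : State N → ℝ} (hG0 : ∀ x, 0 ≤ G x)
    (hG : ∀ x ∈ I, killed (weight lam) (step π) T G x + 1 ≤ G x)
    (hφ : ∀ a, φ (arrivals a) ∈ I) :
    meanHitTime π A μ (fun ω => φ fun j => A 0 j ω) T < ∞ := by
  classical
  set X := chain π A φ with hX
  -- The value `∞` off `I` makes the drift inequality hold at every state, so it is not necessary to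
  -- track that the path stays in `I`.
  set G' : State N → ℝ≥0∞ := fun x => if x ∈ I then ENNReal.ofReal (G x) else ∞ with hG'
  have hdrift : ∀ x, ∑ a, ENNReal.ofReal (weight lam a) * Tᶜ.indicator G' (step π x a) + 1
      ≤ G' x := by
    intro x
    by_cases hx : x ∈ I
    · have h1 : ∀ a, Tᶜ.indicator G' (step π x a)
          = Tᶜ.indicator (fun y => ENNReal.ofReal (G y)) (step π x a) := fun a => by
        simp [Set.indicator_apply, hG', hI x hx a]
      simp only [h1]
      rw [ofReal_killed hpos hlt hG0, ← ENNReal.ofReal_one, ← ENNReal.ofReal_add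
        (killed_nonneg (weight_pos hpos hlt) hG0 x) zero_le_one]
      simpa [hG', hx] using ENNReal.ofReal_le_ofReal (hG x hx)
    · simp [hG', hx]
  have hmeas : ∀ t, Measurable (alive X T t) := fun t =>
    (measurable_alive t).mono (hA.arrivalSigma_le _) le_rfl
  have hstep : ∀ t, (∫⁻ ω, alive X T (t + 1) ω * G' (X (t + 1) ω) ∂μ) + ∫⁻ ω, alive X T t ω ∂μ
      ≤ ∫⁻ ω, alive X T t ω * G' (X t ω) ∂μ := by
    intro t
    rw [hX, lintegral_alive_succ_mul hA hpos hlt, ← hX, ← lintegral_add_right _ (hmeas t)]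
    refine lintegral_mono fun ω => ?_
    calc _ = alive X T t ω * (∑ a, ENNReal.ofReal (weight lam a) *
            Tᶜ.indicator G' (step π (X t ω) a) + 1) := by rw [mul_add, mul_one]
      _ ≤ _ := mul_le_mul_right (hdrift _) _
  have hsum : ∀ n, (∫⁻ ω, alive X T n ω * G' (X n ω) ∂μ)
      + ∑ t ∈ Finset.range n, ∫⁻ ω, alive X T t ω ∂μ ≤ ∫⁻ ω, G' (X 0 ω) ∂μ := by
    intro n
    induction n with
    | zero => simp [alive]
    | succ n ih =>
      rw [Finset.sum_range_succ, add_comm (∑ t ∈ _, _), ← add_assoc]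
      exact (add_le_add_left (hstep n) _).trans ih
  have hfin : ∫⁻ ω, G' (X 0 ω) ∂μ < ∞ := by
    -- The initial state takes almost surely finitely many values, one for each arrival vector at
    -- time 0.
    refine lt_of_le_of_lt (b := ∫⁻ _, ∑ a, ENNReal.ofReal (G (φ (arrivals a))) ∂μ) ?_ ?_
    · refine lintegral_mono_ae ?_
      filter_upwards [hA.ae_eq_arrivals 0] with ω ⟨a, ha⟩
      have h0 : X 0 ω = φ (arrivals a) := congrArg φ ha
      rw [h0]
      simp only [hG', hφ a, if_true]
      exact Finset.single_le_sum (f := fun a => ENNReal.ofReal (G (φ (arrivals a))))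
        (fun _ _ => zero_le) (Finset.mem_univ a)
    · rw [lintegral_const, measure_univ, mul_one]
      exact ENNReal.sum_lt_top.2 fun a _ => ENNReal.ofReal_lt_top
  refine lt_of_le_of_lt ?_ hfin
  calc meanHitTime π A μ (fun ω => φ fun j => A 0 j ω) T
      ≤ ∫⁻ ω, ∑' t, alive X T t ω ∂μ := lintegral_mono fun ω => hitTime_le_tsum_alive X ω
    _ = ∑' t, ∫⁻ ω, alive X T t ω ∂μ := lintegral_tsum fun t => (hmeas t).aemeasurable
    _ ≤ _ := ENNReal.tsum_le_of_sum_range_le fun n => le_trans le_add_self (hsum n)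

lemma lintegral_alive_mul (hA : IsBernoulliArrivals lam A μ) (hpos : ∀ i, 0 < lam i)
    (hlt : ∀ i, lam i < 1) (x : State N) (t : ℕ) {f : State N → ℝ} (hf : ∀ y, 0 ≤ f y) :
    ∫⁻ ω, alive (chain π A fun _ => x) T t ω *
        ENNReal.ofReal (f (chain π A (fun _ => x) t ω)) ∂μ
      = ENNReal.ofReal ((killed (weight lam) (step π) T)^[t] f x) := by
  induction t generalizing f with
  | zero => simp [alive, process]
  | succ t ih =>
    rw [lintegral_alive_succ_mul hA hpos hlt t fun y => ENNReal.ofReal (f y)]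
    simp only [ofReal_killed hpos hlt hf]
    rw [ih fun y => killed_nonneg (weight_pos hpos hlt) hf y, Function.iterate_succ_apply]

/-- Almost every path is eventually killed, so dominated convergence applies to the survival
indicators. -/
lemma tendsto_survival (hA : IsBernoulliArrivals lam A μ) (hpos : ∀ i, 0 < lam i)
    (hlt : ∀ i, lam i < 1) {x : State N}
    (hx : ∀ᵐ ω ∂μ, ∃ t, 1 ≤ t ∧ process π A (fun _ => x) t ω ∈ T) :
    Filter.Tendsto (fun n => survival (weight lam) (step π) T n x) Filter.atTop (nhds 0) := by
  set X := chain π A fun _ => x with hX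
  have h1 : Filter.Tendsto (fun n => ∫⁻ ω, alive X T n ω ∂μ) Filter.atTop
      (nhds (∫⁻ _, 0 ∂μ)) := by
    refine tendsto_lintegral_of_dominated_convergence (fun _ => 1)
      (fun t => (measurable_alive t).mono (hA.arrivalSigma_le _) le_rfl)
      (fun t => Filter.Eventually.of_forall fun ω => alive_le_one X t ω) (by simp) ?_
    filter_upwards [hx] with ω ⟨t, ht, htT⟩
    refine tendsto_const_nhds.congr' ?_
    filter_upwards [Filter.eventually_ge_atTop t] with n hn
    exact (alive_eq_zero ht hn htT).symm
  have h2 : ∀ n, ∫⁻ ω, alive X T n ω ∂μ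
      = ENNReal.ofReal (survival (weight lam) (step π) T n x) := fun n => by
    have := lintegral_alive_mul (T := T) (π := π) hA hpos hlt x n (f := fun _ => 1)
      (fun _ => zero_le_one)
    simp only [ENNReal.ofReal_one, mul_one] at this
    exact this
  simp only [h2, lintegral_zero] at h1
  have h3 := (ENNReal.tendsto_toReal ENNReal.zero_ne_top).comp h1
  simpa [Function.comp_def, ENNReal.toReal_ofReal,
    survival_nonneg (weight_pos hpos hlt)] using h3
end Law

/-! ### The drift of the LEQ policy -/

section Drift

variable {N : ℕ} {lam : Fin N → ℝ} {π : Policy N}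

/-- The contribution of a queue with backlog `q` and age `v` to the Lyapunov function. For an
empty queue that is not served, `(1 - l)⁻¹ ^ v` is a martingale until the next arrival. -/
noncomputable def queuePotential (c l : ℝ) (q v : ℕ) : ℝ :=
  q + c * if q = 0 then (1 - l)⁻¹ ^ v else 0

/-- The Lyapunov function. -/
noncomputable def potential (c : ℝ) (lam : Fin N → ℝ) (x : State N) : ℝ :=
  ∑ j, queuePotential c (lam j) (x.backlog j) (x.age j)

lemma queuePotential_nonneg {c l : ℝ} (hc : 0 ≤ c) (hl : l < 1) (q v : ℕ) :
    0 ≤ queuePotential c l q v := by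
  have h : 0 ≤ (1 - l)⁻¹ ^ v := pow_nonneg (inv_nonneg.2 (sub_nonneg.2 hl.le)) v
  unfold queuePotential
  split_ifs <;> positivity

lemma potential_nonneg {c : ℝ} (hc : 0 ≤ c) (hlt : ∀ i, lam i < 1) (x : State N) :
    0 ≤ potential c lam x :=
  Finset.sum_nonneg fun j _ => queuePotential_nonneg hc (hlt j) _ _

lemma queuePotential_wait {c l : ℝ} (hl : l < 1) (q v : ℕ) :
    l * queuePotential c l (q + 1) (v + 1) + (1 - l) * queuePotential c l q (v + 1)
      = queuePotential c l q v + l := by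
  have h : (1 - l) ≠ 0 := (sub_pos.2 hl).ne'
  unfold queuePotential
  by_cases hq : q = 0
  · subst hq
    simp only [Nat.zero_add, one_ne_zero, if_true, if_false, pow_succ]
    push_cast
    field_simp
    ring
  · simp only [hq, if_false, Nat.succ_ne_zero]
    push_cast
    ring

/-- One packet leaves. The extra `c` covers the case that the queue becomes empty, when its
exponential term appears with age 0. -/
lemma queuePotential_serve {c l : ℝ} (hc : 0 ≤ c) (hl0 : 0 < l) {q : ℕ} (hq : 0 < q) (v : ℕ) :
    l * queuePotential c l (q - 1 + 1) 0 + (1 - l) * queuePotential c l (q - 1) 0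
      ≤ queuePotential c l q v + l - 1 + c := by
  obtain ⟨q, rfl⟩ := Nat.exists_eq_succ_of_ne_zero hq.ne'
  have : 0 ≤ c * l := mul_nonneg hc hl0.le
  unfold queuePotential
  simp only [Nat.succ_ne_zero, Nat.succ_sub_one, if_false]
  push_cast
  split_ifs <;> simp <;> nlinarith

/-- Resetting the age replaces the accumulated exponential by at most `c`; the older the queue, the
larger the gain. -/
lemma queuePotential_waste {c l : ℝ} (hc : 0 ≤ c) (hl0 : 0 < l) (v : ℕ) :
    l * queuePotential c l 1 0 + (1 - l) * queuePotential c l 0 0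
      ≤ queuePotential c l 0 v + l + c - c * (1 - l)⁻¹ ^ v := by
  have : 0 ≤ c * l := mul_nonneg hc hl0.le
  unfold queuePotential
  simp
  nlinarith

/-- The change of the potential, beyond the arrival rates, that is due to the scheduled queue. -/
noncomputable def serviceDrift (c : ℝ) (lam : Fin N → ℝ) (π : Policy N) (x : State N) : ℝ :=
  if 0 < x.backlog (π x) then c - 1 else c - c * (1 - lam (π x))⁻¹ ^ x.age (π x)

lemma sum_weight_potential_le {c : ℝ} (hc : 0 ≤ c) (hpos : ∀ i, 0 < lam i)
    (hlt : ∀ i, lam i < 1) (x : State N) :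
    ∑ a, weight lam a * potential c lam (step π x a)
      ≤ potential c lam x + ∑ j, lam j + serviceDrift c lam π x := by
  let f : Fin N → Bool → ℝ := fun j b =>
    queuePotential c (lam j) (x.backlog j - departure π x j + b.toNat)
      (if j = π x then 0 else x.age j + 1)
  have h1 : ∑ a, weight lam a * potential c lam (step π x a)
      = ∑ j, ∑ a, weight lam a * f j (a j) := by
    rw [Finset.sum_comm]
    simp only [potential, Finset.mul_sum]
    rfl
  have h2 : serviceDrift c lam π x = ∑ j, if j = π x then serviceDrift c lam π x else 0 := by
    simp
  rw [h1, h2, potential, ← Finset.sum_add_distrib, ← Finset.sum_add_distrib]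
  refine Finset.sum_le_sum fun j _ => ?_
  rw [sum_weight_mul j (f j)]
  simp only [f, Bool.toNat_true, Bool.toNat_false, add_zero]
  by_cases hj : j = π x
  · subst hj
    by_cases hq : 0 < x.backlog (π x)
    · simp only [departure, serviceDrift, hq, and_self, if_true]
      linarith [queuePotential_serve hc (hpos (π x)) hq (x.age (π x))]
    · simp only [departure, serviceDrift, hq, and_false, if_true, if_false, Nat.sub_zero]
      rw [Nat.eq_zero_of_not_pos hq, Nat.zero_add]
      linarith [queuePotential_waste hc (hpos (π x)) (x.age (π x))]
  · simp only [departure, hj, false_and, if_false, Nat.sub_zero, add_zero]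
    exact (queuePotential_wait (hlt j) _ _).le

/-- The states with an empty incumbent and small ages. -/
def smallAges (lam : Fin N → ℝ) (K : ℕ) : Set (State N) :=
  {x | x.backlog x.incumbent = 0 ∧ ∀ i, lam i * x.age i ≤ K}

lemma exists_drift (hpos : ∀ i, 0 < lam i) (hlt : ∀ i, lam i < 1) (hsum : ∑ i, lam i < 1)
    (hπ : IsLEQ lam π) :
    ∃ (F : State N → ℝ) (ε : ℝ) (K : ℕ), (∀ x, 0 ≤ F x) ∧ 0 < ε ∧
      ∀ x, ∑ a, weight lam a * F (step π x a)
        ≤ F x - ε + (smallAges lam K).indicator (fun _ => 1) x := by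
  classical
  -- Half the slack: after a service the drift is at most ∑λ + c - 1 = -c, and after any wasted slot
  -- at most ∑λ + c = 1 - c, which explains the indicator of height 1.
  set c := (1 - ∑ i, lam i) / 2 with hc
  have hc0 : 0 < c := by linarith
  have hr : ∀ j, 1 < (1 - lam j)⁻¹ := fun j =>
    (one_lt_inv₀ (sub_pos.2 (hlt j))).2 (by linarith [hpos j])
  -- From age `n j` on, the lost exponential term is at least c(1 + 1/c) = c + 1, so that a wasted
  -- slot has drift at most ∑λ - 1 = -2c.
  choose n hn using fun j => pow_unbounded_of_one_lt (1 + c⁻¹) (hr j)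
  refine ⟨potential c lam, c, ∑ j, n j, potential_nonneg hc0.le hlt, hc0, fun x => ?_⟩
  have hd := sum_weight_potential_le (π := π) hc0.le hpos hlt x
  have hind : 0 ≤ (smallAges lam (∑ j, n j)).indicator (fun _ => (1 : ℝ)) x :=
    Set.indicator_nonneg (fun _ _ => zero_le_one) _
  by_cases hq : 0 < x.backlog (π x)
  · rw [serviceDrift, if_pos hq] at hd
    linarith
  rw [serviceDrift, if_neg hq] at hd
  by_cases hx : x ∈ smallAges lam (∑ j, n j)
  · rw [Set.indicator_of_mem hx]
    have : 0 ≤ c * (1 - lam (π x))⁻¹ ^ x.age (π x) :=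
      mul_nonneg hc0.le (pow_nonneg (by linarith [hr (π x)]) _)
    linarith
  have hinc : x.backlog x.incumbent = 0 := by
    by_contra h
    have := (hπ x).1 (Nat.pos_of_ne_zero h)
    exact hq (this ▸ Nat.pos_of_ne_zero h)
  have hage : n (π x) ≤ x.age (π x) := by
    simp only [smallAges, Set.mem_ofPred_eq, hinc, true_and, not_forall, not_le] at hx
    obtain ⟨i, hi⟩ := hx
    have h1 : ((∑ j, n j : ℕ) : ℝ) < x.age (π x) :=
      (hi.trans_le ((hπ x).2 hinc i)).trans_le
        (mul_le_of_le_one_left (Nat.cast_nonneg _) (hlt _).le)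
    exact (Finset.single_le_sum (fun j _ => Nat.zero_le (n j)) (Finset.mem_univ (π x))).trans
      (Nat.cast_lt.1 h1).le
  have hpow : 1 + c⁻¹ ≤ (1 - lam (π x))⁻¹ ^ x.age (π x) :=
    (hn (π x)).le.trans (pow_le_pow_right₀ (hr _).le hage)
  have := mul_le_mul_of_nonneg_left hpow hc0.le
  rw [mul_add, mul_one, mul_inv_cancel₀ hc0.ne'] at this
  linarith

/-! ### Closed sets that meet the exceptional set in finitely many states -/

/-- The backlogs of the queues other than the incumbent exceed their ages by at most `B`. -/
def boundedExcess (N B : ℕ) : Set (State N) :=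
  {x | ∀ j, j = x.incumbent ∨ x.backlog j ≤ x.age j + B}

/-- An unscheduled queue ages by one and receives at most one packet. An incumbent that is given up
is empty because service is exhaustive, so the bound holds for it as well. -/
lemma step_mem_boundedExcess (hπ : IsLEQ lam π) {B : ℕ} {x : State N}
    (hx : x ∈ boundedExcess N B) (a : Fin N → Bool) : step π x a ∈ boundedExcess N B := by
  intro j
  by_cases hj : j = π x
  · exact .inl hj
  right
  have ha : arrivals a j ≤ 1 := Bool.toNat_le (a j)
  have hq : x.backlog j ≤ x.age j + B := by
    rcases hx j with h | h
    · have : x.backlog x.incumbent = 0 := by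
        by_contra h0
        exact hj (h.trans ((hπ x).1 (Nat.pos_of_ne_zero h0)).symm)
      rw [h, this]
      exact Nat.zero_le _
    · exact h
  simp only [step, next, departure, hj, false_and, if_false]
  omega

/-- The ages are bounded because the rates are positive; they bound all backlogs except the
incumbent's, and that one is zero. -/
lemma finite_smallAges_inter (hpos : ∀ i, 0 < lam i) (K B : ℕ) :
    (smallAges lam K ∩ boundedExcess N B).Finite := by
  choose n hn using fun i => exists_nat_ge (K / lam i : ℝ)
  have hinj : Function.Injective fun x : State N => (x.backlog, x.age, x.incumbent) :=
    fun x y h => by cases x; cases y; simpa using h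
  refine Set.Finite.subset (((Set.finite_Icc (0 : Fin N → ℕ) (fun i => n i + B)).prod
    ((Set.finite_Icc (0 : Fin N → ℕ) n).prod Set.finite_univ)).preimage hinj.injOn) ?_
  rintro x ⟨⟨hinc, hage⟩, hex⟩
  have hv : ∀ i, x.age i ≤ n i := fun i => by
    have h1 : (x.age i : ℝ) ≤ K / lam i := by
      rw [le_div_iff₀ (hpos i), mul_comm]
      exact hage i
    exact_mod_cast h1.trans (hn i)
  refine ⟨⟨fun i => Nat.zero_le _, fun i => ?_⟩, ⟨fun i => Nat.zero_le _, hv⟩, Set.mem_univ _⟩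
  rcases hex i with h | h
  · simp only [h, hinc]
    exact Nat.zero_le _
  · exact h.trans (Nat.add_le_add_right (hv i) B)

/-! ### Reaching the empty system -/

/-- A slot without arrivals. -/
def idle (π : Policy N) (x : State N) : State N := step π x fun _ => false

lemma idle_backlog (x : State N) (j : Fin N) :
    (idle π x).backlog j = x.backlog j - departure π x j := by
  simp [idle, step, next, arrivals]

lemma age_iterate_idle_le {x : State N} {m : ℕ} {i : Fin N} (hi : π ((idle π)^[m] x) = i)
    (k : ℕ) : ((idle π)^[m + 1 + k] x).age i ≤ k := by
  induction k with
  | zero => simp [Function.iterate_succ_apply', idle, step, next, hi]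
  | succ k ih =>
    rw [← add_assoc, Function.iterate_succ_apply']
    simp only [idle, step, next] at ih ⊢
    split_ifs <;> omega

lemma le_age_iterate_idle {x : State N} {j : Fin N} (hj : ∀ n, π ((idle π)^[n] x) ≠ j) (n : ℕ) :
    n ≤ ((idle π)^[n] x).age j := by
  induction n with
  | zero => exact Nat.zero_le _
  | succ n ih =>
    have := (hj n).symm
    rw [Function.iterate_succ_apply']
    change n + 1 ≤ if j = π ((idle π)^[n] x) then 0 else ((idle π)^[n] x).age j + 1
    rw [if_neg this]
    omega

/-- If there are no arrivals, then a nonempty queue is served eventually. -/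
lemma exists_idle_serves (hpos : ∀ i, 0 < lam i) (hlt : ∀ i, lam i < 1) (hπ : IsLEQ lam π)
    {x : State N} {j : Fin N} (hj : 0 < x.backlog j) :
    ∃ n, 0 < ((idle π)^[n] x).backlog (π ((idle π)^[n] x)) := by
  by_contra! hcon
  have hback : ∀ n, ((idle π)^[n] x).backlog = x.backlog := by
    intro n
    induction n with
    | zero => rfl
    | succ n ih =>
      funext i
      have h0 : departure π ((idle π)^[n] x) i = 0 := by
        refine if_neg fun h => ?_
        have := hcon n
        rw [← h.1] at this
        omega
      rw [Function.iterate_succ_apply', idle_backlog, h0, ih, Nat.sub_zero]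
  have hnj : ∀ n, π ((idle π)^[n] x) ≠ j := fun n h => by
    have := hcon n
    rw [h, hback n] at this
    omega
  -- Queue `j` is never scheduled, so after `m` slots its weighted age exceeds `N`. By LEQ every
  -- queue scheduled later then has age above `N`, whereas among `N + 1` consecutive slots two
  -- schedule the same queue.
  obtain ⟨m, hm⟩ := exists_nat_gt (N / lam j : ℝ)
  rw [div_lt_iff₀ (hpos j)] at hm
  have hbig : ∀ n, m ≤ n → N < ((idle π)^[n + 1] x).age (π ((idle π)^[n + 1] x)) := by
    intro n hn
    have hinc : ((idle π)^[n + 1] x).backlog ((idle π)^[n + 1] x).incumbent = 0 := by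
      have h1 : ((idle π)^[n + 1] x).incumbent = π ((idle π)^[n] x) := by
        rw [Function.iterate_succ_apply']; rfl
      have h2 := hcon n
      rw [hback n] at h2
      rw [hback, h1]
      omega
    have h1 := (hπ _).2 hinc j
    have h2 : (m : ℝ) ≤ ((idle π)^[n + 1] x).age j := by
      exact_mod_cast (hn.trans n.le_succ).trans (le_age_iterate_idle hnj (n + 1))
    have h3 := mul_le_mul_of_nonneg_left h2 (hpos j).le
    have h4 : lam (π ((idle π)^[n + 1] x)) * (((idle π)^[n + 1] x).age (π ((idle π)^[n + 1] x)) : ℝ)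
        ≤ ((idle π)^[n + 1] x).age (π ((idle π)^[n + 1] x)) :=
      mul_le_of_le_one_left (Nat.cast_nonneg _) (hlt _).le
    have h5 : (N : ℝ) < ((idle π)^[n + 1] x).age (π ((idle π)^[n + 1] x)) := by linarith
    exact_mod_cast h5
  have hrep : ∀ k l : Fin (N + 1), k < l →
      π ((idle π)^[m + k + 1] x) ≠ π ((idle π)^[m + l + 1] x) := by
    intro k l hkl heq
    have h1 := hbig (m + l) (by omega)
    obtain ⟨d, hd⟩ := Nat.exists_eq_add_of_lt (Fin.lt_def.1 hkl)
    have h2 := age_iterate_idle_le heq d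
    rw [show m + k + 1 + 1 + d = m + l + 1 by omega] at h2
    have := l.isLt
    omega
  obtain ⟨k, l, hkl, heq⟩ := Fintype.exists_ne_map_eq_of_card_lt
    (fun k : Fin (N + 1) => π ((idle π)^[m + k + 1] x)) (by simp)
  rcases lt_or_gt_of_ne hkl with h | h
  · exact hrep k l h heq
  · exact hrep l k h heq.symm

lemma reflTransGen_iterate_idle (x : State N) (n : ℕ) :
    Relation.ReflTransGen (Step (step π)) x ((idle π)^[n] x) := by
  induction n with
  | zero => exact .refl
  | succ n ih =>
    rw [Function.iterate_succ_apply']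
    exact ih.tail ⟨_, rfl⟩

lemma sum_backlog_idle_le (x : State N) :
    ∑ j, (idle π x).backlog j ≤ ∑ j, x.backlog j :=
  Finset.sum_le_sum fun j _ => by rw [idle_backlog]; exact Nat.sub_le _ _

lemma sum_backlog_iterate_idle_le (x : State N) (n : ℕ) :
    ∑ j, ((idle π)^[n] x).backlog j ≤ ∑ j, x.backlog j := by
  induction n with
  | zero => exact le_rfl
  | succ n ih =>
    rw [Function.iterate_succ_apply']
    exact (sum_backlog_idle_le _).trans ih

lemma sum_backlog_idle_lt {x : State N} (hx : 0 < x.backlog (π x)) :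
    ∑ j, (idle π x).backlog j < ∑ j, x.backlog j := by
  refine Finset.sum_lt_sum (fun j _ => ?_) ⟨π x, Finset.mem_univ _, ?_⟩
  · rw [idle_backlog]
    exact Nat.sub_le _ _
  · rw [idle_backlog, departure, if_pos ⟨rfl, hx⟩]
    omega

/-- Slots without arrivals have positive probability, and in a run of them the total backlog keeps
falling until it is zero. -/
lemma reflTransGen_emptyStates (hpos : ∀ i, 0 < lam i) (hlt : ∀ i, lam i < 1)
    (hπ : IsLEQ lam π) (x : State N) :
    ∃ y ∈ emptyStates N, Relation.ReflTransGen (Step (step π)) x y := by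
  induction h : ∑ j, x.backlog j using Nat.strong_induction_on generalizing x with
  | _ n ih =>
    by_cases hx : x ∈ emptyStates N
    · exact ⟨x, hx, .refl⟩
    obtain ⟨j, hj⟩ : ∃ j, x.backlog j ≠ 0 := not_forall.1 hx
    obtain ⟨k, hk⟩ := exists_idle_serves hpos hlt hπ (Nat.pos_of_ne_zero hj)
    have hlt' : ∑ j, ((idle π)^[k + 1] x).backlog j < n := by
      rw [Function.iterate_succ_apply']
      exact (sum_backlog_idle_lt hk).trans_le (h ▸ sum_backlog_iterate_idle_le x k)
    obtain ⟨y, hy, hr⟩ := ih _ hlt' _ rfl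
    exact ⟨y, hy, (reflTransGen_iterate_idle x (k + 1)).trans hr⟩

lemma reach_emptyStates (hpos : ∀ i, 0 < lam i) (hlt : ∀ i, lam i < 1)
    (hπ : IsLEQ lam π) (x : State N) : ∃ y ∈ emptyStates N, Reach (step π) x y := by
  obtain ⟨y, hy, hr⟩ := reflTransGen_emptyStates hpos hlt hπ (idle π x)
  exact ⟨y, hy, .head' ⟨_, rfl⟩ hr⟩

end Drift

/-! ### Stability -/

section Stability

variable {N : ℕ} {lam : Fin N → ℝ} {π : Policy N} {Ω : Type*} [MeasurableSpace Ω]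
  {μ : Measure Ω} [IsProbabilityMeasure μ] {A : ℕ → Fin N → Ω → ℕ}

lemma meanHitTime_lt_top_of_reach (hA : IsBernoulliArrivals lam A μ) (hpos : ∀ i, 0 < lam i)
    (hlt : ∀ i, lam i < 1) (hsum : ∑ i, lam i < 1) (hπ : IsLEQ lam π) {B : ℕ}
    {I T : Set (State N)} (hIB : I ⊆ boundedExcess N B) (hI : ∀ x ∈ I, ∀ a, step π x a ∈ I)
    (hT : ∀ y ∈ I, ∃ m, survival (weight lam) (step π) T m y < 1)
    {φ : (Fin N → ℕ) → State N} (hφ : ∀ a, φ (arrivals a) ∈ I) :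
    meanHitTime π A μ (fun ω => φ fun j => A 0 j ω) T < ∞ := by
  obtain ⟨F, ε, K, hF0, hε, hF⟩ := exists_drift hpos hlt hsum hπ
  obtain ⟨G, hG0, hG⟩ := exists_lyapunov (T := T) (weight_pos hpos hlt) sum_weight
    ((finite_smallAges_inter hpos K B).subset (Set.inter_subset_inter_right _ hIB))
    hF0 hε zero_le_one (fun x _ => hF x) fun y hy => hT y hy.2
  exact meanHitTime_lt_top hA hpos hlt hI hG0 hG hφ

/-- A point `y` of the finite exceptional set is chosen to which all exceptional points reachable
from it lead back. Every state reachable from `y` reaches the exceptional set again, hence also `y`,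
so the drift criterion applies with target `{y}`. -/
lemma exists_reach_positiveRecurrent (hA : IsBernoulliArrivals lam A μ) (hpos : ∀ i, 0 < lam i)
    (hlt : ∀ i, lam i < 1) (hsum : ∑ i, lam i < 1) (hπ : IsLEQ lam π) {B : ℕ} {x : State N}
    (hx : x ∈ boundedExcess N B) :
    ∃ y ∈ positiveRecurrentStates π A μ, Reach (step π) x y := by
  obtain ⟨F, ε, K, hF0, hε, hF⟩ := exists_drift hpos hlt hsum hπ
  have hclosed : ∀ x ∈ boundedExcess N B, ∀ a, step π x a ∈ boundedExcess N B :=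
    fun x hx a => step_mem_boundedExcess hπ hx a
  have hreach : ∀ x ∈ boundedExcess N B,
      ∃ y ∈ smallAges lam K ∩ boundedExcess N B, Reach (step π) x y := fun x hx =>
    exists_reach_of_drift (weight_pos hpos hlt) sum_weight hclosed hF0 hε (fun x _ => hF x) hx
  obtain ⟨y, hy, hxy, hmin⟩ := exists_reach_minimal (finite_smallAges_inter hpos K B)
    Set.inter_subset_right hreach hx
  refine ⟨y, ?_, hxy⟩
  set I : Set (State N) := {z | z ∈ boundedExcess N B ∧ (z = y ∨ Reach (step π) y z)} with hIdef
  have hI : ∀ z ∈ I, ∀ a, step π z a ∈ I := by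
    rintro z ⟨hz, hyz⟩ a
    refine ⟨hclosed z hz a, .inr ?_⟩
    rcases hyz with rfl | hyz
    · exact .single ⟨a, rfl⟩
    · exact hyz.tail ⟨a, rfl⟩
  have hback : ∀ z ∈ I, Reach (step π) z y := by
    rintro z ⟨hz, hyz⟩
    obtain ⟨u, hu, hzu⟩ := hreach z hz
    refine hzu.trans (hmin u hu ?_)
    rcases hyz with rfl | hyz
    · exact hzu
    · exact hyz.trans hzu
  exact meanHitTime_lt_top_of_reach (T := {y}) (φ := fun _ => y) hA hpos hlt hsum hπ (fun z hz => hz.1) hI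
    (fun z hz => exists_survival_lt_one_of_reach (weight_pos hpos hlt) sum_weight (hback z hz) rfl)
    fun _ => ⟨hy.2, .inl rfl⟩

lemma stableFrom (hA : IsBernoulliArrivals lam A μ) (hpos : ∀ i, 0 < lam i)
    (hlt : ∀ i, lam i < 1) (hsum : ∑ i, lam i < 1) (hπ : IsLEQ lam π) {B : ℕ}
    {φ : (Fin N → ℕ) → State N} (hφ : ∀ a, φ (arrivals a) ∈ boundedExcess N B) :
    StableFrom π A μ fun ω => φ fun j => A 0 j ω := by
  have hclosed : ∀ x ∈ boundedExcess N B, ∀ a, step π x a ∈ boundedExcess N B :=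
    fun x hx a => step_mem_boundedExcess hπ hx a
  constructor
  · refine meanHitTime_lt_top_of_reach hA hpos hlt hsum hπ subset_rfl hclosed (fun y hy => ?_) hφ
    obtain ⟨z, hz, hr⟩ := exists_reach_positiveRecurrent hA hpos hlt hsum hπ hy
    exact exists_survival_lt_one_of_reach (weight_pos hpos hlt) sum_weight hr hz
  · refine meanHitTime_lt_top_of_reach hA hpos hlt hsum hπ subset_rfl hclosed (fun y _ => ?_) hφ
    obtain ⟨z, hz, hr⟩ := reach_emptyStates hpos hlt hπ y
    exact exists_survival_lt_one_of_reach (weight_pos hpos hlt) sum_weight hr hz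

lemma mem_boundedExcess_sum (x : State N) : x ∈ boundedExcess N (∑ j, x.backlog j) := fun j =>
  .inr <| (Finset.single_le_sum (fun j _ => Nat.zero_le (x.backlog j)) (Finset.mem_univ j)).trans
    (Nat.le_add_left _ _)

/-- Almost sure return to `x` is inherited by every state the chain visits, so `{x}` is accessible
throughout a closed set containing `x` and the drift criterion gives a finite mean. -/
lemma mem_positiveRecurrentStates_of_recurrent (hA : IsBernoulliArrivals lam A μ)
    (hpos : ∀ i, 0 < lam i) (hlt : ∀ i, lam i < 1) (hsum : ∑ i, lam i < 1) (hπ : IsLEQ lam π)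
    {x : State N} (hx : ∀ᵐ ω ∂μ, ∃ t, 1 ≤ t ∧ process π A (fun _ => x) t ω = x) :
    x ∈ positiveRecurrentStates π A μ := by
  have hw := weight_pos hpos hlt
  have hx0 := tendsto_survival (T := {x}) hA hpos hlt hx
  set I : Set (State N) := {z | z ∈ boundedExcess N (∑ j, x.backlog j) ∧
    Filter.Tendsto (fun n => survival (weight lam) (step π) {x} n z) Filter.atTop (nhds 0)}
    with hIdef
  have hI : ∀ z ∈ I, ∀ a, step π z a ∈ I := by
    rintro z ⟨hz, hz0⟩ a
    refine ⟨step_mem_boundedExcess hπ hz a, ?_⟩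
    -- A transition into `x` is killed and contributes nothing to the survival probability of `z`;
    -- there the recurrence of `x` itself is needed.
    by_cases hax : step π z a = x
    · rw [hax]
      exact hx0
    have hle : ∀ n, weight lam a * survival (weight lam) (step π) {x} n (step π z a)
        ≤ survival (weight lam) (step π) {x} (n + 1) z := fun n => by
      rw [survival_succ, killed]
      refine le_trans (le_of_eq ?_) (Finset.single_le_sum (fun b _ => mul_nonneg (hw b).le
        (Set.indicator_nonneg (fun y _ => survival_nonneg hw n y) _)) (Finset.mem_univ a))
      rw [Set.indicator_of_mem (by simpa using hax)]
    have h1 := squeeze_zero (fun n => mul_nonneg (hw a).le (survival_nonneg hw n _)) hle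
      (hz0.comp (Filter.tendsto_add_atTop_nat 1))
    have h2 := h1.const_mul (weight lam a)⁻¹
    simpa [inv_mul_cancel_left₀ (hw a).ne'] using h2
  exact meanHitTime_lt_top_of_reach (T := {x}) (φ := fun _ => x) hA hpos hlt hsum hπ (fun z hz => hz.1) hI
    (fun z hz => (hz.2.eventually (gt_mem_nhds zero_lt_one)).exists)
    fun _ => ⟨mem_boundedExcess_sum x, hx0⟩

end Stability

end Polling

theorem mainTheorem4 {N : ℕ} (lam : Fin N → ℝ) (hpos : ∀ i, 0 < lam i)
    (hsum : ∑ i, lam i < 1)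
    {Ω : Type*} [MeasurableSpace Ω] (μ : Measure Ω) [IsProbabilityMeasure μ]
    (A : ℕ → Fin N → Ω → ℕ) (hA : Polling.IsBernoulliArrivals lam A μ)
    (π : Polling.Policy N) (hπ : Polling.IsLEQ lam π) :
    Polling.IsStable π A μ := by
  have hlt : ∀ i, lam i < 1 := fun i =>
    (Finset.single_le_sum (fun j _ => (hpos j).le) (Finset.mem_univ i)).trans_lt hsum
  refine ⟨fun x hx => ?_, fun x => ?_, fun v s => ?_⟩
  · exact Polling.mem_positiveRecurrentStates_of_recurrent hA hpos hlt hsum hπ hx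
  · exact Polling.stableFrom (φ := fun _ => x) hA hpos hlt hsum hπ
      fun _ => Polling.mem_boundedExcess_sum x
  · exact Polling.stableFrom (φ := fun q => ⟨q, v, s⟩) (B := 1) hA hpos hlt hsum hπ
      fun a j => .inr ((Bool.toNat_le (a j)).trans (Nat.le_add_left _ _))
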